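/- Conventions. For a set $S$, $\mathrm{fin}(S)$ is the family of finite subsets of $S$, and $\mathrm{fin}(S)^{\mathbb N}$ is ordered by $f\le g$ iff $f(n)\subseteq g(n)$ for all $n$. For partially ordered sets $P,Q$, write $P\preceq Q$ if there is a monotone map $P\to Q$ whose image is cofinal in $Q$; $P$ and $Q$ are cofinally equivalent if $P\preceq Q$ and $Q\preceq P$. The density $d(X)$ of a topological space $X$ is the minimal cardinality of a dense subset of $X$; the local density $ld(x)$ of a point $x\in X$ is the minimal density of a neighborhood of $x$, and $ld(X)=\sup_{x\in X} ld(x)$. The local density of $X$ is realized if $ld(x)=ld(X)$ for some $x\in X$. For an infinite cardinal $\kappa$, a topological group $H$ has a $\mathrm{fin}(\kappa)^{\mathbb N}$-base if there is a monotone map with cofinal image from $\mathrm{fin}(\kappa)^{\mathbb N}$ to the family of neighborhoods of the identity of $H$, ordered by reverse inclusion. An arc is a subspace homeomorphic to $[0,1]$. Theorem. Let $X$ be a complete metric space that is not locally compact, with $d(X)=ld(X)$. Assume that the local density of $X$ is realized or that the cardinal $ld(X)$ has uncountable cofinality. Let $G$ be a metrizable topological group, and let $C(X,G)$ be the topological group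 of continuous functions from $X$ to $G$ with pointwise operations and the compact-open topology. Then: 1. The cardinal $d(X)$ is infinite, and the topological group $C(X,G)$ has a $\mathrm{fin}(d(X))^{\mathbb N}$-base. 2. If $G$ contains an arc, then $C(X,G)$ has a local base at the identity element, consisting of open neighborhoods, that, ordered by reverse inclusion, is cofinally equivalent to $\mathrm{fin}(d(X))^{\mathbb N}$. -/

import Mathlib

open Topology Cardinal

universe u v

/-- `P ⪯ Q`: there is a monotone map from `P` to `Q` whose image is cofinal in `Q`. -/
def CofinalLE (P : Type u) (Q : Type v) [Preorder P] [Preorder Q] : Prop :=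
  ∃ ψ : P → Q, Monotone ψ ∧ IsCofinal (Set.range ψ)

/-- Cofinal equivalence `P ≈ Q` of partially ordered sets. -/
def CofinalEquiv (P : Type u) (Q : Type v) [Preorder P] [Preorder Q] : Prop :=
  CofinalLE P Q ∧ CofinalLE Q P

/-- `fin(κ)^ℕ`: the sequences of finite subsets of a set of cardinality `κ`,
ordered by coordinatewise inclusion. -/
abbrev FinSeq (κ : Cardinal.{u}) : Type u := ℕ → Finset κ.out

/-- The density of a topological space: the minimal cardinality of a dense subset. -/
noncomputable def topDensity (X : Type u) [TopologicalSpace X] : Cardinal.{u} :=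
  sInf {c | ∃ D : Set X, Dense D ∧ #D = c}

/-- The local density of a point: the minimal density of a neighborhood of it
(with the subspace topology). -/
noncomputable def localDensityAt {X : Type u} [TopologicalSpace X] (x : X) : Cardinal.{u} :=
  sInf {c | ∃ N ∈ 𝓝 x, topDensity N = c}

/-- The local density of a space: the supremum of the local densities of its points. -/
noncomputable def localDensity (X : Type u) [TopologicalSpace X] : Cardinal.{u} :=
  ⨆ x : X, localDensityAt x

/-- The supremum defining the local density is over a bounded family, hence a true supremum. -/
theorem localDensityAt_le_localDensity {X : Type u} [TopologicalSpace X] (x : X) :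
    localDensityAt x ≤ localDensity X :=
  le_ciSup Cardinal.bddAbove_of_small x

/-- The local density of the space is attained at some point. -/
def LocalDensityRealized (X : Type u) [TopologicalSpace X] : Prop :=
  ∃ x : X, localDensityAt x = localDensity X

/-- The neighborhoods of the identity of `G`, ordered by reverse inclusion. -/
abbrev NhdsOne (G : Type u) [TopologicalSpace G] [One G] : Type u :=
  {U : Set G // U ∈ 𝓝 (1 : G)}ᵒᵈ

/-- For Hausdorff `X` and a (not necessarily commutative) topological group `G`, the group `C(X, G)`
with the compact-open topology is a topological group. -/
instance isTopologicalGroup_continuousMap {X : Type u} [TopologicalSpace X] [T2Space X]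
    {G : Type v} [Group G] [TopologicalSpace G] [IsTopologicalGroup G] :
    IsTopologicalGroup C(X, G) where
  continuous_mul := by
    refine continuous_iff_continuousAt.2 fun p => ?_
    refine ContinuousMap.tendsto_compactOpen_iff_forall _ _ |>.2 fun K hK => ?_
    have : CompactSpace K := isCompact_iff_compactSpace.1 hK
    have h : Continuous fun q : C(X, G) × C(X, G) => q.1.restrict K * q.2.restrict K :=
      ((ContinuousMap.continuous_restrict K).comp continuous_fst).mul
        ((ContinuousMap.continuous_restrict K).comp continuous_snd)
    exact h.tendsto p
  continuous_inv := ContinuousMap.continuous_postcomp (⟨fun g : G => g⁻¹, continuous_inv⟩ : C(G, G))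

/-- `G` has a `fin(κ)^ℕ`-base (`κ` infinite): there is a monotone cofinal map from `fin(κ)^ℕ`
to the neighborhoods of the identity, ordered by reverse inclusion; the base is its image. -/
def HasFinSeqBase (κ : Cardinal.{u}) (G : Type v) [Group G] [TopologicalSpace G]
    [IsTopologicalGroup G] : Prop :=
  ℵ₀ ≤ κ ∧ CofinalLE (FinSeq κ) (NhdsOne G)

/-- `B` is a local base at `x` (consisting of open neighborhoods of `x`). -/
def IsLocalBase {Y : Type u} [TopologicalSpace Y] (x : Y) (B : Set (Set Y)) : Prop :=
  (∀ U ∈ B, IsOpen U ∧ x ∈ U) ∧ ∀ N ∈ 𝓝 x, ∃ U ∈ B, U ⊆ N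

/-- `Y` contains an arc, that is, a homeomorphic copy of the unit interval. -/
def ContainsArc (Y : Type u) [TopologicalSpace Y] : Prop :=
  ∃ γ : unitInterval → Y, IsEmbedding γ

open TopologicalSpace Filter Set

theorem CofinalLE.trans {P Q R : Type*} [Preorder P] [Preorder Q] [Preorder R]
    (h₁ : CofinalLE P Q) (h₂ : CofinalLE Q R) : CofinalLE P R := by
  obtain ⟨φ, hφ, hφc⟩ := h₁
  obtain ⟨ψ, hψ, hψc⟩ := h₂
  refine ⟨ψ ∘ φ, hψ.comp hφ, fun r => ?_⟩
  obtain ⟨_, ⟨q, rfl⟩, hq⟩ := hψc r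
  obtain ⟨_, ⟨p, rfl⟩, hp⟩ := hφc q
  exact ⟨_, ⟨p, rfl⟩, hq.trans (hψ hp)⟩

theorem exists_dense_mk_eq_topDensity (X : Type u) [TopologicalSpace X] :
    ∃ D : Set X, Dense D ∧ #D = topDensity X :=
  csInf_mem (s := {c | ∃ D : Set X, Dense D ∧ #D = c}) ⟨_, Set.univ, dense_univ, rfl⟩

theorem topDensity_le {X : Type u} [TopologicalSpace X] {D : Set X} (hD : Dense D) :
    topDensity X ≤ #D :=
  csInf_le' ⟨D, hD, rfl⟩

theorem exists_denseRange_out (X : Type u) [TopologicalSpace X] :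
    ∃ d : (topDensity X).out → X, DenseRange d := by
  obtain ⟨D, hD, hc⟩ := exists_dense_mk_eq_topDensity X
  obtain ⟨e⟩ : Nonempty ((topDensity X).out ≃ D) := by
    rw [← Cardinal.eq, mk_out, hc]
  refine ⟨fun i => e i, ?_⟩
  have : range (fun i => (e i : X)) = D := by
    rw [range_comp' (g := Subtype.val), e.surjective.range_eq, image_univ, Subtype.range_coe]
  rw [DenseRange, this]
  exact hD

theorem aleph0_le_topDensity {X : Type u} [TopologicalSpace X] [T1Space X]
    (hX : ¬ LocallyCompactSpace X) : ℵ₀ ≤ topDensity X := by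
  by_contra! h
  obtain ⟨D, hD, hc⟩ := exists_dense_mk_eq_topDensity X
  rw [← hc, lt_aleph0_iff_set_finite] at h
  have hu : D = Set.univ := by rw [← hD.closure_eq, h.isClosed.closure_eq]
  have : Finite X := finite_univ_iff.1 (hu ▸ h)
  exact hX inferInstance

/-- The compact set of points that are, for each `n`, within `1 / (n + 1)` of `d i` for
some `i ∈ f n`. -/
def netCompacts {X : Type u} [MetricSpace X] [CompleteSpace X] {ι : Type v} (d : ι → X)
    (f : ℕ → Finset ι) : Compacts X where
  carrier := ⋂ n : ℕ, ⋃ i ∈ f n, Metric.closedBall (d i) (1 / (n + 1))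
  isCompact' := by
    refine TotallyBounded.isCompact_of_isClosed ?_ (isClosed_iInter fun n =>
      (f n).finite_toSet.isClosed_biUnion fun i _ => Metric.isClosed_closedBall)
    refine Metric.totallyBounded_iff.2 fun ε hε => ?_
    obtain ⟨n, hn⟩ := exists_nat_one_div_lt hε
    refine ⟨d '' f n, (f n).finite_toSet.image d, ?_⟩
    refine (iInter_subset _ n).trans ?_
    simp only [biUnion_image]
    exact iUnion₂_mono fun i _ => Metric.closedBall_subset_ball hn

theorem netCompacts_mono {X : Type u} [MetricSpace X] [CompleteSpace X] {ι : Type v} (d : ι → X) :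
    Monotone (netCompacts d) := fun _ _ h =>
  iInter_mono fun n => biUnion_subset_biUnion_left (h n)

theorem exists_le_netCompacts {X : Type u} [MetricSpace X] [CompleteSpace X] {ι : Type v}
    {d : ι → X} (hd : DenseRange d) (K : Compacts X) : ∃ f, K ≤ netCompacts d f := by
  have h : ∀ n : ℕ, ∃ t : Finset ι, (K : Set X) ⊆ ⋃ i ∈ t, Metric.ball (d i) (1 / (n + 1)) := by
    intro n
    refine K.isCompact.elim_finite_subcover _ (fun i => Metric.isOpen_ball) fun x _ => ?_
    obtain ⟨i, hi⟩ := hd.exists_dist_lt x (Nat.one_div_pos_of_nat (n := n) (α := ℝ))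
    exact mem_iUnion.2 ⟨i, hi⟩
  choose f hf using h
  exact ⟨f, subset_iInter fun n => (hf n).trans
    (iUnion₂_mono fun i _ => Metric.ball_subset_closedBall)⟩

/-- The open neighborhoods of the identity. -/
def openNhdsOne (H : Type v) [TopologicalSpace H] [One H] : Set (Set H) :=
  {U | IsOpen U ∧ (1 : H) ∈ U}

theorem isLocalBase_openNhdsOne (H : Type v) [TopologicalSpace H] [One H] :
    IsLocalBase (1 : H) (openNhdsOne H) := by
  refine ⟨fun _ h => h, fun N hN => ?_⟩
  obtain ⟨U, hUN, hU, h1⟩ := mem_nhds_iff.1 hN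
  exact ⟨U, ⟨hU, h1⟩, hUN⟩

theorem cofinalLE_openNhdsOne_nhdsOne (H : Type v) [TopologicalSpace H] [One H] :
    CofinalLE (openNhdsOne H)ᵒᵈ (NhdsOne H) := by
  refine ⟨fun U => OrderDual.toDual ⟨(OrderDual.ofDual U).1,
    (OrderDual.ofDual U).2.1.mem_nhds (OrderDual.ofDual U).2.2⟩, fun U V h => h, fun N => ?_⟩
  obtain ⟨U, hU, hUN⟩ := (isLocalBase_openNhdsOne H).2 _ (OrderDual.ofDual N).2
  exact ⟨_, ⟨OrderDual.toDual ⟨U, hU⟩, rfl⟩, hUN⟩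

theorem cofinalLE_finSeq_openNhdsOne {X : Type u} [MetricSpace X] [CompleteSpace X]
    (hκ : ℵ₀ ≤ topDensity X) {G : Type v} [Group G] [TopologicalSpace G] [IsTopologicalGroup G]
    [FirstCountableTopology G] :
    CofinalLE (FinSeq (topDensity X)) (openNhdsOne C(X, G))ᵒᵈ := by
  obtain ⟨d, hd⟩ := exists_denseRange_out X
  have : Infinite (topDensity X).out := by rwa [infinite_iff, mk_out]
  obtain ⟨V, hV⟩ := (𝓝 (1 : G)).exists_antitone_basis
  let W : ℕ → Set G := fun n => interior (V n)
  have hW1 : ∀ n, (1 : G) ∈ W n := fun n => mem_interior_iff_mem_nhds.2 (hV.1.mem_of_mem trivial)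
  let Φ : FinSeq (topDensity X) → Set C(X, G) := fun f =>
    {h | MapsTo h (netCompacts d fun n => f (n + 1) : Compacts X) (W (f 0).card)}
  have hΦ : ∀ f, Φ f ∈ openNhdsOne C(X, G) := fun f =>
    ⟨ContinuousMap.isOpen_setOfPred_mapsTo (Compacts.isCompact _) isOpen_interior,
      fun _ _ => hW1 _⟩
  refine ⟨fun f => OrderDual.toDual ⟨Φ f, hΦ f⟩, fun f g hfg => ?_, fun N => ?_⟩
  · show Φ g ⊆ Φ f
    exact fun h hh => (hh.mono_left (netCompacts_mono d fun n => hfg (n + 1))).mono_right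
      (interior_mono (hV.2 (Finset.card_le_card (hfg 0))))
  · have hN := (OrderDual.ofDual N).2.1.mem_nhds (OrderDual.ofDual N).2.2
    obtain ⟨⟨K, n⟩, ⟨hK, -⟩, hKn⟩ := (hV.1.nhds_continuousMapConst (X := X)).mem_iff.1 hN
    obtain ⟨f, hf⟩ := exists_le_netCompacts hd ⟨K, hK⟩
    obtain ⟨t, ht⟩ := Infinite.exists_subset_card_eq (topDensity X).out n
    refine ⟨_, ⟨fun k => Nat.casesOn k t f, rfl⟩, fun h hh => hKn fun x hx => ?_⟩
    have := hh (hf hx)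
    have ht0 : W t.card = W n := by rw [ht]
    replace this : h x ∈ W t.card := this
    rw [ht0] at this
    exact interior_subset this

theorem cofinalLE_nhdsOne_compacts {X : Type u} [MetricSpace X] {G : Type v} [Group G]
    [TopologicalSpace G] [IsTopologicalGroup G] [T1Space G] (hG : ContainsArc G) :
    CofinalLE (NhdsOne C(X, G)) (Compacts X) := by
  obtain ⟨γ, hγ⟩ := hG
  let η : unitInterval → G := fun t => (γ 0)⁻¹ * γ t
  have hη : Continuous η := continuous_const.mul hγ.continuous
  have hη0 : η 0 = 1 := inv_mul_cancel _
  have hη1 : η 1 ≠ 1 := fun h => zero_ne_one (hγ.injective (inv_mul_eq_one.1 h))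
  let S : Set C(X, G) → Set X := fun U => {x | ∀ h ∈ U, h x ∈ ({η 1}ᶜ : Set G)}
  have hS : ∀ U ∈ 𝓝 (1 : C(X, G)), ∃ K, IsCompact K ∧ S U ⊆ K := by
    intro U hU
    obtain ⟨⟨K, V⟩, ⟨hK, hV⟩, hKV⟩ :=
      ((𝓝 (1 : G)).basis_sets.nhds_continuousMapConst (X := X)).mem_iff.1 hU
    refine ⟨K, hK, fun x hx => ?_⟩
    by_contra hxK
    obtain ⟨g, hg0, hg1, hg⟩ := exists_continuous_zero_one_of_isClosed hK.isClosed
      (isClosed_singleton (x := x)) (disjoint_singleton_right.2 hxK)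
    let p : C(X, G) := ⟨fun y => η ⟨g y, hg y⟩, hη.comp (g.continuous.subtype_mk _)⟩
    have hp : p ∈ U := hKV fun y hy => by
      have : (⟨g y, hg y⟩ : unitInterval) = 0 := Subtype.ext (hg0 hy)
      show η _ ∈ V
      rw [this, hη0]
      exact mem_of_mem_nhds hV
    refine hx p hp ?_
    have : (⟨g x, hg x⟩ : unitInterval) = 1 := Subtype.ext (hg1 rfl)
    show η _ = η 1
    rw [this]
  refine ⟨fun U => ⟨closure (S (OrderDual.ofDual U).1), ?_⟩, fun U V hUV => ?_, fun K => ?_⟩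
  · obtain ⟨K, hK, hSK⟩ := hS _ (OrderDual.ofDual U).2
    exact hK.closure_of_subset hSK
  · exact closure_mono fun x hx h hh => hx h (hUV hh)
  · refine ⟨_, ⟨OrderDual.toDual ⟨{h | MapsTo h K {η 1}ᶜ}, ?_⟩, rfl⟩, fun x hx =>
      subset_closure fun h hh => hh hx⟩
    exact (ContinuousMap.isOpen_setOfPred_mapsTo K.isCompact isOpen_compl_singleton).mem_nhds
      fun _ _ => hη1.symm

open scoped NNReal in
theorem exists_isSeparated_isCover {X : Type u} [MetricSpace X] (ε : ℝ≥0) (s : Set X) :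
    ∃ N ⊆ s, Metric.IsSeparated ε N ∧ Metric.IsCover ε s N := by
  obtain ⟨N, hN⟩ := zorn_subset {N : Set X | N ⊆ s ∧ Metric.IsSeparated ε N} fun c hc hchain =>
    ⟨⋃₀ c, ⟨sUnion_subset fun t ht => (hc ht).1,
      (pairwise_sUnion hchain.directedOn).2 fun t ht => (hc ht).2⟩, fun t => subset_sUnion_of_mem⟩
  exact ⟨N, hN.prop.1, hN.prop.2, .of_maximal_isSeparated hN⟩

open scoped NNReal in
theorem Metric.IsSeparated.finite_inter {X : Type u} [MetricSpace X] {ε : ℝ≥0} (hε : ε ≠ 0)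
    {A K : Set X} (hA : Metric.IsSeparated ε A) (hK : IsCompact K) : (K ∩ A).Finite := by
  obtain ⟨N, hN, hNf, hc⟩ := Metric.exists_finite_isCover_of_totallyBounded hε
    (hK.totallyBounded.subset inter_subset_left : TotallyBounded (K ∩ A))
  refine hNf.subset fun x hx => ?_
  obtain ⟨y, hy, hxy⟩ := hc hx
  by_contra hxN
  exact (hA hx.2 (hN hy).2 fun h => hxN (h ▸ hy)).not_ge hxy

theorem exists_monotone_compacts_finset {X : Type u} [MetricSpace X] [CompleteSpace X] {I : Type u}
    {B : Set X} (hBc : IsClosed B) (hB : ¬ IsCompact B) {W : Set I} (hW : #W ≤ topDensity B) :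
    ∃ ρ : Compacts X → Finset I, Monotone ρ ∧ ∀ F : Finset I, (F : Set I) ⊆ W →
      ∃ T : Finset X, (T : Set X) ⊆ B ∧ ∀ K : Compacts X, (T : Set X) ⊆ K → F ⊆ ρ K := by
  classical
  let δ : ℕ → NNReal := fun m => 1 / (m + 1)
  have hδ : ∀ m, δ m ≠ 0 := fun m => by positivity
  have hδr : ∀ m, (δ m : ℝ) = 1 / (m + 1) := fun m => by simp [δ]
  choose A hAB hAs hAc using fun m => exists_isSeparated_isCover (δ m) B
  have hcov : ∀ m, ∀ x ∈ B, ∃ y ∈ A m, dist x y ≤ 1 / (m + 1) := fun m x hx => by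
    obtain ⟨y, hy, hxy⟩ := hAc m hx
    refine ⟨y, hy, ?_⟩
    rw [← hδr m]
    have : edist x y ≤ δ m := hxy
    rwa [edist_nndist, ENNReal.coe_le_coe, ← NNReal.coe_le_coe, coe_nndist] at this
  have hfin : ∀ m (K : Compacts X), ((K : Set X) ∩ A m).Finite := fun m K =>
    (hAs m).finite_inter (hδ m) K.isCompact
  obtain ⟨k, hk⟩ : ∃ k, (A k).Infinite := by
    by_contra! h
    refine hB (TotallyBounded.isCompact_of_isClosed (Metric.totallyBounded_iff.2 fun ε hε => ?_) hBc)
    obtain ⟨m, hm⟩ := exists_nat_one_div_lt hε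
    refine ⟨A m, h m, fun x hx => ?_⟩
    obtain ⟨y, hy, hxy⟩ := hcov m x hx
    exact mem_biUnion hy (hxy.trans_lt hm)
  have hdens : Dense ((↑) ⁻¹' (⋃ m, A m) : Set B) := by
    refine Metric.dense_iff.2 fun x r hr => ?_
    obtain ⟨m, hm⟩ := exists_nat_one_div_lt hr
    obtain ⟨y, hy, hxy⟩ := hcov m x x.2
    refine ⟨⟨y, hAB m hy⟩, ?_, mem_iUnion_of_mem m hy⟩
    rw [Metric.mem_ball, dist_comm]
    exact hxy.trans_lt hm
  obtain ⟨e⟩ : Nonempty (W ↪ ((↑) ⁻¹' (⋃ m, A m) : Set B)) :=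
    le_def _ _ |>.1 (hW.trans (topDensity_le hdens))
  have he : ∀ w, ∃ m, ((e w : B) : X) ∈ A m := fun w => mem_iUnion.1 (e w).2
  have hinj : Function.Injective fun w => ((e w : B) : X) :=
    Subtype.val_injective.comp (Subtype.val_injective.comp e.injective)
  let P : Compacts X → Set I := fun K => {i | ∃ h : i ∈ W, ((e ⟨i, h⟩ : B) : X) ∈
    ⋃ m ≤ (hfin k K).toFinset.card, (K : Set X) ∩ A m}
  have hP : ∀ K, (P K).Finite := fun K => by
    have h1 : (⋃ m ≤ (hfin k K).toFinset.card, (K : Set X) ∩ A m).Finite :=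
      (finite_Iic _).biUnion fun m _ => hfin m K
    refine ((h1.preimage hinj.injOn).image (fun w : W => (w : I))).subset ?_
    rintro i ⟨h, hi⟩
    exact ⟨⟨i, h⟩, hi, rfl⟩
  refine ⟨fun K => (hP K).toFinset, fun K L hKL => ?_, fun F hF => ?_⟩
  · refine Finite.toFinset_subset_toFinset.2 ?_
    rintro i ⟨h, hi⟩
    simp only [mem_iUnion] at hi
    obtain ⟨m, hm, hmK, hmA⟩ := hi
    refine ⟨h, mem_iUnion₂.2 ⟨m, hm.trans (Finset.card_le_card ?_), hKL hmK, hmA⟩⟩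
    exact Finite.toFinset_subset_toFinset.2 (inter_subset_inter_left _ hKL)
  · choose μ hμ using he
    let T₀ : Finset X := F.attach.image fun i => ((e ⟨i.1, hF i.2⟩ : B) : X)
    obtain ⟨T₁, hT₁, hc⟩ := hk.exists_subset_card_eq
      (F.attach.sup fun i => μ ⟨i.1, hF i.2⟩)
    refine ⟨T₀ ∪ T₁, ?_, fun K hK i hi => ?_⟩
    · rw [Finset.coe_union]
      refine union_subset ?_ (hT₁.trans (hAB k))
      simp only [T₀, Finset.coe_image]
      rintro _ ⟨i, -, rfl⟩
      exact Subtype.prop _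
    · rw [Finset.coe_union, union_subset_iff] at hK
      rw [Finite.mem_toFinset]
      refine ⟨hF hi, mem_iUnion₂.2 ⟨μ ⟨i, hF hi⟩, ?_, hK.1 ?_, hμ _⟩⟩
      · refine (Finset.le_sup (f := fun i : F => μ ⟨i.1, hF i.2⟩)
          (Finset.mem_attach F ⟨i, hi⟩)).trans ?_
        rw [← hc]
        exact Finset.card_le_card fun x hx => (hfin k K).mem_toFinset.2 ⟨hK.2 hx, hT₁ hx⟩
      · exact Finset.mem_coe.2 (Finset.mem_image_of_mem _ (Finset.mem_attach F ⟨i, hi⟩))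

theorem exists_monotone_compacts_finsetSeq {X : Type u} [MetricSpace X] [CompleteSpace X]
    {I : Type u} (x : X) (hx : ∀ r > 0, ¬ IsCompact (Metric.closedBall x r)) {W : Set I}
    (hW : #W ≤ localDensityAt x) :
    ∃ ψ : Compacts X → ℕ → Finset I, Monotone ψ ∧ ∀ f : ℕ → Finset I, (∀ n, (f n : Set I) ⊆ W) →
      ∃ K : Compacts X, x ∈ K ∧ f ≤ ψ K := by
  let r : ℕ → ℝ := fun n => 1 / (n + 1)
  have hr : ∀ n, 0 < r n := fun n => Nat.one_div_pos_of_nat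
  have hd : ∀ n, #W ≤ topDensity (Metric.closedBall x (r n)) := fun n =>
    hW.trans (csInf_le' ⟨_, Metric.closedBall_mem_nhds x (hr n), rfl⟩)
  choose ρ hρ hρF using fun n =>
    exists_monotone_compacts_finset Metric.isClosed_closedBall (hx _ (hr n)) (hd n)
  refine ⟨fun K n => ρ n K, fun K L h n => hρ n h, fun f hf => ?_⟩
  choose T hTB hT using fun n => hρF n (f n) (hf n)
  have hK : IsCompact (insert x (⋃ n, (T n : Set X))) := by
    refine isCompact_of_finite_subcover fun {ι} U hUo hU => ?_
    obtain ⟨i₀, hi₀⟩ := mem_iUnion.1 (hU (mem_insert _ _))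
    obtain ⟨ε, hε, hball⟩ := Metric.isOpen_iff.1 (hUo i₀) x hi₀
    obtain ⟨N, hN⟩ := exists_nat_one_div_lt hε
    have hfin : (⋃ n < N, (T n : Set X)).Finite :=
      (finite_Iio N).biUnion fun n _ => (T n).finite_toSet
    obtain ⟨t, ht⟩ := hfin.isCompact.elim_finite_subcover U hUo
      ((iUnion₂_subset_iUnion _ _).trans ((subset_insert _ _).trans hU))
    classical
    refine ⟨insert i₀ t, ?_⟩
    rintro y (rfl | hy)
    · exact mem_biUnion (Finset.mem_insert_self _ _) hi₀
    · obtain ⟨n, hn⟩ := mem_iUnion.1 hy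
      by_cases hnN : n < N
      · obtain ⟨i, hi, hyi⟩ := mem_iUnion₂.1 (ht (mem_iUnion₂.2 ⟨n, hnN, hn⟩))
        exact mem_biUnion (Finset.mem_insert_of_mem hi) hyi
      · refine mem_biUnion (Finset.mem_insert_self _ _) (hball ?_)
        refine (Metric.mem_closedBall.1 (hTB n hn)).trans_lt (lt_of_le_of_lt ?_ hN)
        exact one_div_le_one_div_of_le (by positivity) (by exact_mod_cast by omega)
  exact ⟨⟨_, hK⟩, mem_insert _ _, fun n => hT n _
    ((subset_iUnion (fun n => (T n : Set X)) n).trans (subset_insert _ _))⟩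

theorem not_isCompact_closedBall_of_aleph0_lt {X : Type u} [MetricSpace X] {x : X}
    (hx : ℵ₀ < localDensityAt x) {r : ℝ} (hr : 0 < r) : ¬ IsCompact (Metric.closedBall x r) := by
  intro h
  obtain ⟨D, hD, hDd⟩ := h.isSeparable.separableSpace.exists_countable_dense
  have hle : localDensityAt x ≤ topDensity (Metric.closedBall x r) :=
    csInf_le' ⟨_, Metric.closedBall_mem_nhds x hr, rfl⟩
  exact hx.not_ge <| hle.trans <| (topDensity_le hDd).trans (le_aleph0_iff_set_countable.2 hD)

theorem cofinalLE_compacts_finSeq_of_point {X : Type u} [MetricSpace X] [CompleteSpace X]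
    {κ : Cardinal.{u}} (x : X) (hx : ∀ r > 0, ¬ IsCompact (Metric.closedBall x r))
    (hκ : κ ≤ localDensityAt x) : CofinalLE (Compacts X) (FinSeq κ) := by
  obtain ⟨ψ, hψ, h⟩ := exists_monotone_compacts_finsetSeq (I := κ.out) x hx (W := Set.univ)
    (by rwa [mk_univ, mk_out])
  refine ⟨ψ, hψ, fun f => ?_⟩
  obtain ⟨K, -, hK⟩ := h f fun n => subset_univ _
  exact ⟨_, ⟨K, rfl⟩, hK⟩

theorem exists_forall_not_isCompact_closedBall {X : Type u} [MetricSpace X]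
    (hX : ¬ LocallyCompactSpace X) : ∃ x : X, ∀ r > 0, ¬ IsCompact (Metric.closedBall x r) := by
  by_contra! h
  have : WeaklyLocallyCompactSpace X := ⟨fun x =>
    let ⟨_, hr, hc⟩ := h x
    ⟨_, hc, Metric.closedBall_mem_nhds x hr⟩⟩
  exact hX inferInstance

theorem aleph0_le_localDensityAt {X : Type u} [MetricSpace X] {x : X}
    (hx : ∀ r > 0, ¬ IsCompact (Metric.closedBall x r)) : ℵ₀ ≤ localDensityAt x := by
  refine le_csInf ⟨_, Set.univ, univ_mem, rfl⟩ ?_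
  rintro _ ⟨N, hN, rfl⟩
  refine aleph0_le_topDensity fun h => ?_
  obtain ⟨K, hK, hKx⟩ := exists_compact_mem_nhds (⟨x, mem_of_mem_nhds hN⟩ : N)
  have h1 : (↑) '' K ∈ 𝓝 x := by
    rw [← map_nhds_subtype_coe_eq_nhds (mem_of_mem_nhds hN) hN]
    exact image_mem_map hKx
  obtain ⟨r, hr, hrK⟩ := Metric.nhds_basis_closedBall.mem_iff.1 h1
  exact hx r hr ((hK.image continuous_subtype_val).of_isClosed_subset Metric.isClosed_closedBall hrK)

theorem exists_ball_localDensityAt_le {X : Type u} [MetricSpace X] (x : X) :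
    ∃ n : ℕ, ∀ y, dist y x < 1 / (n + 1) → localDensityAt y ≤ localDensityAt x := by
  obtain ⟨N, hN, hNx⟩ : ∃ N ∈ 𝓝 x, topDensity N = localDensityAt x :=
    csInf_mem (s := {c | ∃ N ∈ 𝓝 x, topDensity N = c}) ⟨_, Set.univ, univ_mem, rfl⟩
  obtain ⟨r, hr, hrN⟩ := Metric.mem_nhds_iff.1 hN
  obtain ⟨n, hn⟩ := exists_nat_one_div_lt hr
  refine ⟨n, fun y hy => hNx ▸ csInf_le' ⟨N, ?_, rfl⟩⟩
  exact mem_of_superset (Metric.isOpen_ball.mem_nhds (Metric.mem_ball.2 (hy.trans hn))) hrN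

/-- If `localDensity X` has uncountable cofinality, then some uniformly separated set has points of
local density above any given cardinal below `localDensity X`. -/
theorem exists_isSeparated_localDensityAt_unbounded {X : Type u} [MetricSpace X]
    (hcof : ℵ₀ < (localDensity X).ord.cof) :
    ∃ ε : NNReal, ε ≠ 0 ∧ ∃ D : Set X, Metric.IsSeparated ε D ∧
      ∀ c < localDensity X, ∃ p ∈ D, c < localDensityAt p := by
  choose n hn using fun x : X => exists_ball_localDensityAt_le x
  obtain ⟨m, hm⟩ : ∃ m, ∀ c < localDensity X, ∃ x, n x = m ∧ c < localDensityAt x := by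
    by_contra! h
    choose c hc hcx using h
    have hlt : ⨆ m : ULift.{u} ℕ, c m.down < localDensity X :=
      iSup_lt_of_lt_cof_ord (by simpa using hcof) fun m => hc _
    have hle : ∀ x : X, localDensityAt x ≤ ⨆ m : ULift.{u} ℕ, c m.down := fun x =>
      (hcx _ x rfl).trans
        (le_ciSup (f := fun m : ULift.{u} ℕ => c m.down) Cardinal.bddAbove_of_small ⟨n x⟩)
    exact hlt.not_ge (ciSup_le' hle)
  obtain ⟨D, hDm, hD⟩ := exists_subset_bijOn {x | n x = m} (localDensityAt (X := X))
  have key : ∀ p ∈ D, ∀ q, localDensityAt p < localDensityAt q → 1 / ((m : ℝ) + 1) ≤ dist q p := by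
    intro p hp q hpq
    by_contra! h
    have hpm : n p = m := hDm hp
    exact hpq.not_ge (hn p q (by rwa [hpm]))
  refine ⟨1 / (m + 1) / 2, by positivity, D, fun p hp q hq hpq => ?_, fun c hc => ?_⟩
  · have h1 : 1 / ((m : ℝ) + 1) ≤ dist p q := by
      rcases lt_or_gt_of_ne fun h => hpq (hD.injOn hp hq h) with h | h
      · rw [dist_comm]
        exact key p hp q h
      · exact key q hq p h
    show _ < edist p q
    rw [edist_nndist, ENNReal.coe_lt_coe, ← NNReal.coe_lt_coe, coe_nndist]
    push_cast
    exact (half_lt_self (by positivity)).trans_le h1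
  · obtain ⟨x, hx, hcx⟩ := hm c hc
    obtain ⟨p, hp, hpx⟩ := hD.surjOn (mem_image_of_mem _ hx)
    exact ⟨p, hp, by rwa [hpx]⟩

/-- A set of cardinality `κ` carries a family of subsets indexed by cardinals, such that the one at
`c` has at most `c` elements and, when `κ` has uncountable cofinality, every countable set is
included in all those with large enough index below `κ`. -/
theorem exists_subsets_mk_le {I : Type u} (hcof : ℵ₀ < (#I).ord.cof) :
    ∃ W : Cardinal.{u} → Set I, (∀ c, #(W c) ≤ c) ∧
      ∀ A : Set I, A.Countable → ∃ c < #I, ∀ c' > c, A ⊆ W c' := by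
  obtain ⟨e⟩ : Nonempty (I ≃ Iio (#I).ord) := by
    rw [← Cardinal.lift_mk_eq'.{u, u + 1}, mk_Iio_ordinal]
    simp
  refine ⟨fun c => {i | (e i : Ordinal) < c.ord}, fun c => ?_, fun A hA => ?_⟩
  · have h : Cardinal.lift.{u + 1} #{i | (e i : Ordinal) < c.ord} ≤
        Cardinal.lift.{u} #(Iio c.ord) :=
      lift_mk_le_lift_mk_of_injective (f := fun i : {i | (e i : Ordinal) < c.ord} =>
        (⟨e i.1, i.2⟩ : Iio c.ord)) fun i j hij =>
          Subtype.ext (e.injective (Subtype.ext (Subtype.mk.inj hij)))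
    rw [mk_Iio_ordinal] at h
    simpa using h
  · let o : Ordinal.{u} := ⨆ i : A, (e i : Ordinal)
    have ho : o < (#I).ord :=
      Ordinal.iSup_lt_of_lt_cof ((le_aleph0_iff_set_countable.2 hA).trans_lt hcof) fun i =>
        (e i).2
    refine ⟨o.card, lt_ord.1 ho, fun c hc i hi => ?_⟩
    exact (le_ciSup (f := fun i : A => (e i : Ordinal)) Ordinal.bddAbove_of_small ⟨i, hi⟩).trans_lt
      (lt_ord.2 hc)

theorem cofinalLE_compacts_finSeq_of_cof {X : Type u} [MetricSpace X] [CompleteSpace X]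
    (hcof : ℵ₀ < (localDensity X).ord.cof) :
    CofinalLE (Compacts X) (FinSeq (localDensity X)) := by
  classical
  have hκ : ℵ₀ < localDensity X := hcof.trans_le (Ordinal.cof_ord_le _)
  obtain ⟨ε, hε, D, hD, hDu⟩ := exists_isSeparated_localDensityAt_unbounded hcof
  obtain ⟨W, hW, hA⟩ := exists_subsets_mk_le (I := (localDensity X).out) (by rwa [mk_out])
  have hψ : ∀ p : X, ∃ ψ : Compacts X → FinSeq (localDensity X), Monotone ψ ∧
      (ℵ₀ < localDensityAt p → ∀ f : FinSeq (localDensity X),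
        (∀ n, (f n : Set (localDensity X).out) ⊆ W (localDensityAt p)) →
        ∃ K : Compacts X, p ∈ K ∧ f ≤ ψ K) := by
    intro p
    by_cases hp : ℵ₀ < localDensityAt p
    · obtain ⟨ψ, h1, h2⟩ := exists_monotone_compacts_finsetSeq p
        (fun r hr => not_isCompact_closedBall_of_aleph0_lt hp hr) (hW _)
      exact ⟨ψ, h1, fun _ => h2⟩
    · exact ⟨fun _ _ => ∅, monotone_const, fun h => (hp h).elim⟩
  choose ψ hψm hψc using hψ
  have hfin : ∀ K : Compacts X, ((K : Set X) ∩ D).Finite := fun K =>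
    hD.finite_inter hε K.isCompact
  refine ⟨fun K n => (hfin K).toFinset.biUnion fun p => ψ p K n, fun K L hKL n => ?_, fun f => ?_⟩
  · exact (Finset.biUnion_subset_biUnion_of_subset_left _ (Finite.toFinset_subset_toFinset.2
      (inter_subset_inter_left _ hKL))).trans (Finset.biUnion_mono fun p _ => hψm p hKL n)
  · obtain ⟨c, hc, hcW⟩ := hA (⋃ n, (f n : Set (localDensity X).out))
      (countable_iUnion fun n => (f n).countable_toSet)
    rw [mk_out] at hc
    obtain ⟨p, hp, hcp⟩ := hDu (max c ℵ₀) (max_lt hc hκ)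
    obtain ⟨K, hpK, hK⟩ := hψc p ((le_max_right _ _).trans_lt hcp) f fun n =>
      (subset_iUnion (fun n => (f n : Set (localDensity X).out)) n).trans
        (hcW _ ((le_max_left _ _).trans_lt hcp))
    refine ⟨_, ⟨K, rfl⟩, fun n => (hK n).trans ?_⟩
    exact Finset.subset_biUnion_of_mem (fun p => ψ p K n) ((hfin K).mem_toFinset.2 ⟨hpK, hp⟩)

theorem cofinalLE_compacts_finSeq {X : Type u} [MetricSpace X] [CompleteSpace X]
    (hX : ¬ LocallyCompactSpace X)
    (hld : LocalDensityRealized X ∨ ℵ₀ < (localDensity X).ord.cof) :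
    CofinalLE (Compacts X) (FinSeq (localDensity X)) := by
  obtain ⟨x₀, hx₀⟩ := exists_forall_not_isCompact_closedBall hX
  rcases le_or_gt (localDensity X) ℵ₀ with h | h
  · exact cofinalLE_compacts_finSeq_of_point x₀ hx₀ (h.trans (aleph0_le_localDensityAt hx₀))
  rcases hld with ⟨x, hx⟩ | hcof
  · exact cofinalLE_compacts_finSeq_of_point x
      (fun r hr => not_isCompact_closedBall_of_aleph0_lt (hx ▸ h) hr) hx.ge
  · exact cofinalLE_compacts_finSeq_of_cof hcof

theorem mainTheorem5 {X : Type u} [MetricSpace X] [CompleteSpace X]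
    (hX : ¬ LocallyCompactSpace X)
    (hd : topDensity X = localDensity X)
    (hld : LocalDensityRealized X ∨ ℵ₀ < (localDensity X).ord.cof)
    {G : Type v} [Group G] [TopologicalSpace G] [IsTopologicalGroup G]
    [TopologicalSpace.MetrizableSpace G] :
    HasFinSeqBase (topDensity X) C(X, G) ∧
      (ContainsArc G → ∃ B : Set (Set C(X, G)), IsLocalBase (1 : C(X, G)) B ∧
        CofinalEquiv (↥B)ᵒᵈ (FinSeq (topDensity X))) := by
  let _ := metrizableSpaceMetric G
  have hκ := aleph0_le_topDensity hX
  have h := cofinalLE_finSeq_openNhdsOne hκ (G := G)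
  have hN := cofinalLE_openNhdsOne_nhdsOne C(X, G)
  refine ⟨⟨hκ, h.trans hN⟩, fun hG => ⟨_, isLocalBase_openNhdsOne _, ?_, h⟩⟩
  rw [hd]
  exact hN.trans ((cofinalLE_nhdsOne_compacts hG).trans (cofinalLE_compacts_finSeq hX hld))
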